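/- All directed graphs are finite with nonempty vertex set, and have no parallel edges. A directed graph is twinless strongly connected if for all vertices $a,b$ there are a path $p$ from $a$ to $b$ and a path $q$ from $b$ to $a$ such that for no edge $(x,y)$ of $p$ the path $q$ uses $(y,x)$. A twinless strongly connected component (TSCC) is a maximal nonempty vertex set inducing a twinless strongly connected subgraph. A directed graph with at least $3$ vertices is $2$-vertex-connected (resp. $2$-vertex-twinless-connected) if it is strongly connected (resp. twinless strongly connected) and remains so after the removal of any one vertex. A $2$-vertex-twinless-connected component of $G$ is a maximal vertex set $U$ such that $G[U]$ is $2$-vertex-twinless-connected. In a strongly (resp. twinless strongly) connected graph, a strong (resp. twinless) articulation point is a vertex whose removal leaves a graph that is not strongly (resp. twinless strongly) connected. In the flowgraph of a graph with start vertex $v$, a vertex $u$ dominates $x$ if every path from $v$ to $x$ contains $u$; $u\ne v$ is a non-trivial dominator if it dominates some $x\neq u$; $M(w)$ denotes the set of vertices $x\neq v$ whose immediate dominator (the dominator of $x$ other than $x$ that is dominated by all dominators of $x$ other than $x$) is $w$, i.e. the direct successors of $w$ in the dominator tree. Consider the following recursive algorithm, applied to a graph $G=(V,E)$. 1. If $G$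 is $2$-vertex-twinless-connected, output $V$ and stop. 2. Otherwise, if $G$ is not $2$-vertex-connected: choose a vertex $v$ that is not a strong articulation point (any vertex $v$ if all vertices are strong articulation points). Of the dominator trees of the flowgraphs $(V,E,v)$ and $(V,E^{r},v)$, where $E^r$ is the set of reversed edges, choose one with the larger number of non-trivial dominators (either one in case of a tie). For each $w\in V$ with $|M(w)|\ge 2$ in this tree: if $G[M(w)\cup\{w\}]$ is twinless strongly connected, apply the algorithm recursively to it; if not, apply the algorithm recursively to $G[C]$ for each TSCC $C$ of $G[M(w)\cup\{w\}]$ with $|C|\ge 3$. Output everything that the recursive calls output. 3. Otherwise (so $G$ is $2$-vertex-connected but not $2$-vertex-twinless-connected): choose a twinless articulation point $v$ of $G$. For each TSCC $B$ of $G\setminus\{v\}$ and each TSCC $C$ of $G[B\cup\{v\}]$, apply the algorithm recursively to $G[C]$. Output everything that the recursive calls output. **Lemma.** Let $G$ be a twinless strongly connected graph. Then, whatever choices are made, the algorithm applied to $G$ never gets stuck and terminates, and the set of all vertex sets that it outputs is exactly the set of $2$-vertex-twinless-connected components of $G$. -/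

import Mathlib

namespace Twinless

variable {V : Type*}

/-- `IsPath G S a b p`: the list `p` of vertices is a directed path from `a` to `b` in the induced
subgraph `G[S]`. (Vertices may be repeated; every notion below only depends on the existence of
paths with few vertices or few edges, so restricting to simple paths gives the same notions.) -/
def IsPath (G : Digraph V) (S : Set V) (a b : V) (p : List V) : Prop :=
  p.IsChain G.Adj ∧ p.head? = some a ∧ p.getLast? = some b ∧ ∀ x ∈ p, x ∈ S

/-- The directed edge `(x, y)` is used by the path `p`. -/
def UsesEdge (p : List V) (x y : V) : Prop := [x, y] <:+: p

/-- The graph with all edges reversed. -/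
def reverse (G : Digraph V) : Digraph V where
  Adj x y := G.Adj y x

/-- `G[S]` is strongly connected. -/
def StronglyConnected (G : Digraph V) (S : Set V) : Prop :=
  ∀ a ∈ S, ∀ b ∈ S, ∃ p, IsPath G S a b p

/-- `G[S]` is twinless strongly connected: for all vertices `a`, `b` there are a path `p` from `a`
to `b` and a path `q` from `b` to `a` such that `q` uses no edge antiparallel to an edge of `p`. -/
def TwinlessStronglyConnected (G : Digraph V) (S : Set V) : Prop :=
  ∀ a ∈ S, ∀ b ∈ S, ∃ p q, IsPath G S a b p ∧ IsPath G S b a q ∧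
    ∀ x y, UsesEdge p x y → ¬ UsesEdge q y x

/-- `C` is (the vertex set of) a twinless strongly connected component of `G[S]`. -/
def IsTSCC (G : Digraph V) (S C : Set V) : Prop :=
  Maximal (fun D : Set V => D ⊆ S ∧ D.Nonempty ∧ TwinlessStronglyConnected G D) C

/-- `G[S]` is `k`-vertex-connected. -/
def VertexConnected (G : Digraph V) (k : ℕ) (S : Set V) : Prop :=
  StronglyConnected G S ∧ k + 1 ≤ S.ncard ∧
    ∀ U ⊆ S, U.ncard < k → StronglyConnected G (S \ U)

/-- `G[S]` is `k`-vertex-twinless-connected. -/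
def VertexTwinlessConnected (G : Digraph V) (k : ℕ) (S : Set V) : Prop :=
  TwinlessStronglyConnected G S ∧ k + 1 ≤ S.ncard ∧
    ∀ U ⊆ S, U.ncard < k → TwinlessStronglyConnected G (S \ U)

/-- `C` is a `2`-vertex-twinless-connected component of `G`. -/
def IsTwoVTCC (G : Digraph V) (C : Set V) : Prop :=
  Maximal (fun D : Set V => VertexTwinlessConnected G 2 D) C

/-- `v` is a strong articulation point of the strongly connected graph `G[S]`. -/
def IsStrongArticulationPoint (G : Digraph V) (S : Set V) (v : V) : Prop :=
  v ∈ S ∧ ¬ StronglyConnected G (S \ {v})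

/-- `v` is a twinless articulation point of the twinless strongly connected graph `G[S]`. -/
def IsTwinlessArticulationPoint (G : Digraph V) (S : Set V) (v : V) : Prop :=
  v ∈ S ∧ ¬ TwinlessStronglyConnected G (S \ {v})

/-- `u` dominates `x` in the flowgraph of `G[S]` with start vertex `v`: every path from `v` to `x`
goes through `u`. -/
def Dominates (G : Digraph V) (S : Set V) (v u x : V) : Prop :=
  u ∈ S ∧ x ∈ S ∧ ∀ p, IsPath G S v x p → u ∈ p

/-- `u` is a non-trivial dominator in the flowgraph of `G[S]` with start vertex `v`: it is not the
start vertex and it dominates some vertex other than itself. -/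
def IsNontrivialDominator (G : Digraph V) (S : Set V) (v u : V) : Prop :=
  u ≠ v ∧ ∃ x, x ≠ u ∧ Dominates G S v u x

/-- `w` is the immediate dominator of `x`, that is, `(w, x)` is an edge of the dominator tree of the
flowgraph of `G[S]` with start vertex `v`. -/
def IsImmediateDominator (G : Digraph V) (S : Set V) (v w x : V) : Prop :=
  x ≠ v ∧ w ≠ x ∧ Dominates G S v w x ∧
    ∀ u, u ≠ x → Dominates G S v u x → Dominates G S v u w

/-- The set `M(w)` of direct successors of `w` in the dominator tree of the flowgraph of `G[S]` with
start vertex `v`. -/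
def directSuccessors (G : Digraph V) (S : Set V) (v w : V) : Set V :=
  {x | IsImmediateDominator G S v w x}

/-! ### The algorithm

The algorithm is applied to the vertex sets `S` of induced subgraphs `G[S]`. -/

/-- The admissible choices of the start vertex: if all vertices of `G[S]` are strong articulation
points, any vertex; otherwise a vertex that is not a strong articulation point. -/
def AdmissibleStart (G : Digraph V) (S : Set V) (v : V) : Prop :=
  v ∈ S ∧ ((∀ x ∈ S, IsStrongArticulationPoint G S x) ∨ ¬ IsStrongArticulationPoint G S v)

/-- The admissible choices of the dominator tree, for the start vertex `v`: `D` is `G` or the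
reversed graph, and the dominator tree for `D` has at least as many non-trivial dominators as the
other one. -/
def AdmissibleTree (G : Digraph V) (S : Set V) (v : V) (D : Digraph V) : Prop :=
  (D = G ∧ {u | IsNontrivialDominator (reverse G) S v u}.ncard ≤
      {u | IsNontrivialDominator G S v u}.ncard) ∨
  (D = reverse G ∧ {u | IsNontrivialDominator G S v u}.ncard ≤
      {u | IsNontrivialDominator (reverse G) S v u}.ncard)

/-- `DominatorCall G S v D w C`: when the dominator tree of the flowgraph of `D[S]` with start vertex
`v` has been chosen, the iteration of the loop for the vertex `w` calls the algorithm recursively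
on `G[C]`. -/
def DominatorCall (G : Digraph V) (S : Set V) (v : V) (D : Digraph V) (w : V) (C : Set V) : Prop :=
  w ∈ S ∧ 2 ≤ (directSuccessors D S v w).ncard ∧
    ((¬ TwinlessStronglyConnected G (directSuccessors D S v w ∪ {w}) ∧
        IsTSCC G (directSuccessors D S v w ∪ {w}) C ∧ 3 ≤ C.ncard) ∨
     (TwinlessStronglyConnected G (directSuccessors D S v w ∪ {w}) ∧
        C = directSuccessors D S v w ∪ {w}))

/-- `ArticulationCall G S v B C`: when the twinless articulation point `v` of `G[S]` has been chosen,
the iteration of the loop for the twinless strongly connected component `B` of `G[S] ∖ {v}` calls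
the algorithm recursively on `G[C]`. -/
def ArticulationCall (G : Digraph V) (S : Set V) (v : V) (B C : Set V) : Prop :=
  IsTSCC G (S \ {v}) B ∧ IsTSCC G (B ∪ {v}) C

/-- `Computes G S out`: some execution of the algorithm on `G[S]` terminates and outputs exactly the
vertex sets in `out`. An execution may make any admissible choice at each point, and
independent choices in distinct recursive calls; `res` collects what the calls output. -/
inductive Computes (G : Digraph V) : Set V → Set (Set V) → Prop
  | connected (S : Set V) (h : VertexTwinlessConnected G 2 S) : Computes G S {S}
  | dominator (S : Set V) (h : ¬ VertexTwinlessConnected G 2 S) (h' : ¬ VertexConnected G 2 S)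
      (v : V) (hv : AdmissibleStart G S v) (D : Digraph V) (hD : AdmissibleTree G S v D)
      (res : V → Set V → Set (Set V))
      (hres : ∀ w C, DominatorCall G S v D w C → Computes G C (res w C)) :
      Computes G S {U | ∃ w C, DominatorCall G S v D w C ∧ U ∈ res w C}
  | articulation (S : Set V) (h : ¬ VertexTwinlessConnected G 2 S) (h' : VertexConnected G 2 S)
      (v : V) (hv : IsTwinlessArticulationPoint G S v)
      (res : Set V → Set V → Set (Set V))
      (hres : ∀ B C, ArticulationCall G S v B C → Computes G C (res B C)) :
      Computes G S {U | ∃ B C, ArticulationCall G S v B C ∧ U ∈ res B C}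

/-- `Terminates G S`: whatever admissible choices are made, the execution of the algorithm on `G[S]`
never gets stuck (each required choice is possible) and the recursion is finite. -/
inductive Terminates (G : Digraph V) : Set V → Prop
  | connected (S : Set V) (h : VertexTwinlessConnected G 2 S) : Terminates G S
  | dominator (S : Set V) (h : ¬ VertexTwinlessConnected G 2 S) (h' : ¬ VertexConnected G 2 S)
      (hstart : ∃ v, AdmissibleStart G S v)
      (htree : ∀ v, AdmissibleStart G S v → ∃ D, AdmissibleTree G S v D)
      (hcall : ∀ v D w C, AdmissibleStart G S v → AdmissibleTree G S v D →
        DominatorCall G S v D w C → Terminates G C) : Terminates G S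
  | articulation (S : Set V) (h : ¬ VertexTwinlessConnected G 2 S) (h' : VertexConnected G 2 S)
      (hpoint : ∃ v, IsTwinlessArticulationPoint G S v)
      (hcall : ∀ v B C, IsTwinlessArticulationPoint G S v →
        ArticulationCall G S v B C → Terminates G C) : Terminates G S

end Twinless

/-! The proof is an induction on the vertex set `S` of the current call. Each recursive call is on a
strictly smaller, nonempty, twinless strongly connected set, and the components of `G[S]` are those
of the called sets. By `components_eq_of_calls` the latter needs two facts: every
2-vertex-twinless-connected `U ⊆ S` lies in a called set, and called sets sharing three vertices
coincide.

For articulation calls both facts hold because TSCCs are disjoint, that is, because intersecting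
twinless strongly connected sets have a twinless strongly connected union. Concatenating paths could
create twin edges, so this goes through a criterion on cuts
(`TwinlessCuts.twinlessStronglyConnected`), which passes to unions at once.

For dominator calls, a vertex `y` dominates all or none of `U \ {y}`, so `U` lies in some `M(w) ∪
{w}`; by uniqueness of immediate dominators two such sets share at most two vertices. Progress uses
the selection rules: `M(w) ∪ {w} = S` would leave neither flowgraph a non-trivial dominator, and
then no vertex but the start could be a strong articulation point. -/

namespace Twinless

variable {V : Type*}

/-! ### Paths and reachability -/

/-- `b` can be reached from `a` inside `G[S]`. -/
def Reach (G : Digraph V) (S : Set V) (a b : V) : Prop :=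
  a ∈ S ∧ Relation.ReflTransGen (fun x y => G.Adj x y ∧ x ∈ S ∧ y ∈ S) a b

theorem Reach.refl {G : Digraph V} {S : Set V} {a : V} (h : a ∈ S) : Reach G S a a :=
  ⟨h, .refl⟩

theorem Reach.left_mem {G : Digraph V} {S : Set V} {a b : V} (h : Reach G S a b) : a ∈ S := h.1

theorem Reach.right_mem {G : Digraph V} {S : Set V} {a b : V} (h : Reach G S a b) : b ∈ S := by
  obtain ⟨ha, h⟩ := h
  cases h with
  | refl => exact ha
  | tail _ h => exact h.2.2

theorem Reach.trans {G : Digraph V} {S : Set V} {a b c : V} (h : Reach G S a b)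
    (h' : Reach G S b c) : Reach G S a c :=
  ⟨h.1, h.2.trans h'.2⟩

theorem Reach.head {G : Digraph V} {S : Set V} {a b c : V} (ha : a ∈ S) (hab : G.Adj a b)
    (h : Reach G S b c) : Reach G S a c :=
  ⟨ha, .head ⟨hab, ha, h.1⟩ h.2⟩

theorem Reach.mono {G : Digraph V} {S T : Set V} {a b : V} (h : Reach G S a b) (hST : S ⊆ T) :
    Reach G T a b :=
  ⟨hST h.1, Relation.ReflTransGen.mono (fun _ _ h => ⟨h.1, hST h.2.1, hST h.2.2⟩) _ _ h.2⟩

theorem reach_reverse {G : Digraph V} {S : Set V} {a b : V} :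
    Reach (reverse G) S a b ↔ Reach G S b a := by
  have key : ∀ {H : Digraph V} {a b : V}, Reach H S a b → Reach (reverse H) S b a := by
    intro H a b h
    exact ⟨h.right_mem, Relation.ReflTransGen.mono (fun x y h => ⟨h.1, h.2.2, h.2.1⟩) _ _
      (Relation.ReflTransGen.swap _ _ h.2)⟩
  exact ⟨key, key⟩

theorem IsPath.reach {G : Digraph V} {S : Set V} {a b : V} {p : List V} (h : IsPath G S a b p) :
    Reach G S a b := by
  induction p generalizing a with
  | nil => simp [IsPath] at h
  | cons c l ih =>
    obtain ⟨hc, ha, hb, hS⟩ := h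
    obtain rfl : c = a := by simpa using ha
    cases l with
    | nil =>
      obtain rfl : c = b := by simpa using hb
      exact .refl (hS _ (by simp))
    | cons d l =>
      rw [List.isChain_cons_cons] at hc
      exact .head (hS _ (by simp)) hc.1
        (ih ⟨hc.2, rfl, by simpa using hb, fun x hx => hS x (List.mem_cons_of_mem _ hx)⟩)

theorem exists_isPath_iff {G : Digraph V} {S : Set V} {a b : V} :
    (∃ p, IsPath G S a b p) ↔ Reach G S a b := by
  refine ⟨fun ⟨p, hp⟩ => hp.reach, ?_⟩
  rintro ⟨ha, h⟩
  have hb : b ∈ S := Reach.right_mem ⟨ha, h⟩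
  clear ha
  induction h using Relation.ReflTransGen.head_induction_on with
  | refl => exact ⟨[b], by simpa [IsPath] using hb⟩
  | head h' _ ih =>
    obtain ⟨p, hc, hh, hl, hS⟩ := ih
    cases p with
    | nil => simp at hh
    | cons d l =>
      simp only [List.head?_cons, Option.some.injEq] at hh
      subst hh
      refine ⟨_ :: d :: l, List.isChain_cons_cons.2 ⟨h'.1, hc⟩, rfl, by simpa using hl, ?_⟩
      intro x hx
      rcases List.mem_cons.1 hx with rfl | hx
      · exact h'.2.1
      · exact hS x hx

theorem stronglyConnected_iff {G : Digraph V} {S : Set V} :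
    StronglyConnected G S ↔ ∀ a ∈ S, ∀ b ∈ S, Reach G S a b := by
  simp only [StronglyConnected, exists_isPath_iff]

theorem IsPath.adj_of_usesEdge {G : Digraph V} {S : Set V} {a b x y : V} {p : List V}
    (h : IsPath G S a b p) (hxy : UsesEdge p x y) : G.Adj x y := by
  have := h.1.infix hxy
  simpa using this

theorem IsPath.exists_usesEdge_crossing {G : Digraph V} {S A : Set V} {a b : V} {p : List V}
    (h : IsPath G S a b p) (ha : a ∈ A) (hb : b ∉ A) :
    ∃ x y, UsesEdge p x y ∧ x ∈ A ∧ y ∈ S \ A := by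
  induction p generalizing a with
  | nil => simp [IsPath] at h
  | cons c l ih =>
    obtain ⟨hc, ha', hb', hS⟩ := h
    obtain rfl : c = a := by simpa using ha'
    cases l with
    | nil =>
      obtain rfl : c = b := by simpa using hb'
      exact absurd ha hb
    | cons d l =>
      rw [List.isChain_cons_cons] at hc
      by_cases hd : d ∈ A
      · obtain ⟨x, y, hxy, hx, hy⟩ := ih ⟨hc.2, rfl, by simpa using hb',
          fun x hx => hS x (List.mem_cons_of_mem _ hx)⟩ hd
        exact ⟨x, y, hxy.trans (List.suffix_cons _ _).isInfix, hx, hy⟩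
      · exact ⟨c, d, ⟨[], l, by simp⟩, ha, hS _ (by simp), hd⟩

/-! ### The cut criterion for twinless strong connectivity -/

/-- Every nontrivial cut of `G[S]` is crossed by an edge in each direction, and these edges can be
chosen not to be antiparallel to each other. -/
def TwinlessCuts (G : Digraph V) (S : Set V) : Prop :=
  ∀ A ⊆ S, A.Nonempty → A ≠ S → ∃ x ∈ A, ∃ y ∈ S \ A, ∃ x' ∈ A, ∃ y' ∈ S \ A,
    G.Adj x y ∧ G.Adj y' x' ∧ ¬ (x = x' ∧ y = y')

theorem TwinlessStronglyConnected.twinlessCuts {G : Digraph V} {S : Set V}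
    (h : TwinlessStronglyConnected G S) : TwinlessCuts G S := by
  intro A hAS ⟨a, ha⟩ hne
  obtain ⟨b, hb, hbA⟩ : ∃ b ∈ S, b ∉ A := by
    by_contra! hcon
    exact hne (hAS.antisymm hcon)
  obtain ⟨p, q, hp, hq, hpq⟩ := h a (hAS ha) b hb
  obtain ⟨x, y, hxy, hx, hy⟩ := hp.exists_usesEdge_crossing ha hbA
  obtain ⟨y', x', hxy', hy', hx'⟩ := hq.exists_usesEdge_crossing (A := S \ A) ⟨hb, hbA⟩
    (fun h => h.2 ha)
  refine ⟨x, hx, y, hy, x', by_contra fun hn => hx'.2 ⟨hx'.1, hn⟩, y', hy',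
    hp.adj_of_usesEdge hxy, hq.adj_of_usesEdge hxy', ?_⟩
  rintro ⟨rfl, rfl⟩
  exact hpq _ _ hxy hxy'

theorem reach_of_cuts {G : Digraph V} {S : Set V}
    (h : ∀ A ⊆ S, A.Nonempty → A ≠ S → ∃ x ∈ A, ∃ y ∈ S \ A, G.Adj x y) {a b : V}
    (ha : a ∈ S) (hb : b ∈ S) : Reach G S a b := by
  by_contra hab
  obtain ⟨x, hx, y, hy, hxy⟩ := h {x | Reach G S a x} (fun x hx => hx.right_mem)
    ⟨a, .refl ha⟩ (fun h => hab (h.symm ▸ hb : b ∈ {x | Reach G S a x}))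
  exact hy.2 (Reach.trans hx (.head hx.right_mem hxy (.refl hy.1)))

theorem TwinlessCuts.reach {G : Digraph V} {S : Set V} (h : TwinlessCuts G S) {a b : V}
    (ha : a ∈ S) (hb : b ∈ S) : Reach G S a b :=
  reach_of_cuts (fun A hA hne hS => by
    obtain ⟨x, hx, y, hy, _, _, _, _, hxy, -⟩ := h A hA hne hS
    exact ⟨x, hx, y, hy, hxy⟩) ha hb

/-- The digraph with the given set of edges. -/
def ofEdges (E : Set (V × V)) : Digraph V where
  Adj x y := (x, y) ∈ E

/-- If deleting the edge `(x, y)` breaks the cut criterion although `(y, x)` is present, then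
`(x, y)` is the only edge leaving some set. -/
theorem exists_cut_of_not_twinlessCuts_diff {E : Set (V × V)} {S : Set V} {x y : V}
    (hE : TwinlessCuts (ofEdges E) S) (hyx : (y, x) ∈ E)
    (h : ¬ TwinlessCuts (ofEdges (E \ {(x, y)})) S) :
    ∃ A ⊆ S, x ∈ A ∧ y ∈ S \ A ∧ ∀ u ∈ A, ∀ w ∈ S \ A, (u, w) ∈ E → u = x ∧ w = y := by
  simp only [TwinlessCuts, not_forall] at h
  obtain ⟨A, hAS, hne, hA, hno⟩ := h
  have hno' : ∀ u ∈ A, ∀ w ∈ S \ A, ∀ u' ∈ A, ∀ w' ∈ S \ A, (u, w) ∈ E → (w', u') ∈ E →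
      ¬ (u = u' ∧ w = w') → (u, w) = (x, y) ∨ (w', u') = (x, y) := by
    intro u hu w hw u' hu' w' hw' h1 h2 h3
    by_contra! hcon
    exact hno ⟨u, hu, w, hw, u', hu', w', hw', ⟨h1, hcon.1⟩, ⟨h2, hcon.2⟩, h3⟩
  obtain ⟨u, hu, w, hw, u', hu', w', hw', h1, h2, h3⟩ := hE A hAS hne hA
  rcases hno' u hu w hw u' hu' w' hw' h1 h2 h3 with h | h
  · obtain ⟨rfl, rfl⟩ := Prod.mk.inj h
    -- Here `(x, y)` leaves `A` and `(y, x)` enters it. Any other edge leaving `A` would form with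
    -- `(y, x)` a good pair that survives the deletion.
    refine ⟨A, hAS, hu, hw, fun a ha b hb hab => ?_⟩
    by_contra hcon
    rcases hno' a ha b hb u hu w hw hab hyx hcon with h | h
    · exact hcon (Prod.mk.inj h)
    · exact hw.2 ((Prod.mk.inj h).1 ▸ hu : w ∈ A)
  · obtain ⟨rfl, rfl⟩ := Prod.mk.inj h
    refine ⟨S \ A, Set.sdiff_subset, hw', ⟨hAS hu', fun h => h.2 hu'⟩, fun a ha b hb hab => ?_⟩
    have hbA : b ∈ A := by_contra fun hn => hb.2 ⟨hb.1, hn⟩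
    by_contra hcon
    rcases hno' u' hu' w' hw' b hbA a ha hyx hab (fun h => hcon ⟨h.2.symm, h.1.symm⟩) with h | h
    · exact hw'.2 ((Prod.mk.inj h).1 ▸ hu' : w' ∈ A)
    · exact hcon (Prod.mk.inj h)

/-- An inclusion-minimal edge set satisfying the criterion has no antiparallel edges, so any two
paths in it are twinless. -/
theorem TwinlessCuts.twinlessStronglyConnected [Finite V] {G : Digraph V} {S : Set V}
    (h : TwinlessCuts G S) : TwinlessStronglyConnected G S := by
  obtain ⟨E, hE⟩ := (Set.toFinite {E : Set (V × V) | (∀ e ∈ E, G.Adj e.1 e.2) ∧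
    TwinlessCuts (ofEdges E) S}).exists_minimal ⟨{e | G.Adj e.1 e.2}, fun e he => he, h⟩
  have hEG := hE.prop.1
  have hcut := hE.prop.2
  have hdel : ∀ e ∈ E, ¬ TwinlessCuts (ofEdges (E \ {e})) S := fun e he hc =>
    (hE.le_of_le ⟨fun f hf => hEG f hf.1, hc⟩ Set.sdiff_subset he).2 rfl
  have htwin : ∀ x y, (x, y) ∈ E → (y, x) ∉ E := by
    intro x y hxy hyx
    obtain ⟨A, hAS, hxA, hyA, hA⟩ := exists_cut_of_not_twinlessCuts_diff hcut hyx (hdel _ hxy)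
    obtain ⟨B, hBS, hyB, hxB, hB⟩ := exists_cut_of_not_twinlessCuts_diff hcut hxy (hdel _ hyx)
    -- Uncrossing: `(x, y)` alone leaves `A` and `(y, x)` alone leaves `B`, so no edge leaves `A ∩
    -- B` or `A ∪ B`. Hence `B = S \ A`, and only this twin pair crosses `A`.
    have hdisj : ¬ (A ∩ B).Nonempty := by
      intro hne
      obtain ⟨u, hu, w, hw, _, _, _, _, huw, -⟩ := hcut (A ∩ B)
        (Set.inter_subset_left.trans hAS) hne (fun h => hxB.2 (h ▸ hxB.1 : x ∈ A ∩ B).2)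
      by_cases hwA : w ∈ A
      · exact hyA.2 ((hB u hu.2 w ⟨hw.1, fun h => hw.2 ⟨hwA, h⟩⟩ huw).1 ▸ hu.1)
      · exact hxB.2 ((hA u hu.1 w ⟨hw.1, hwA⟩ huw).1 ▸ hu.2)
    have hunion : A ∪ B = S := by
      by_contra hne
      obtain ⟨u, hu, w, hw, _, _, _, _, huw, -⟩ := hcut (A ∪ B)
        (Set.union_subset hAS hBS) ⟨x, .inl hxA⟩ hne
      have hwA : w ∉ A := fun h => hw.2 (.inl h)
      have hwB : w ∉ B := fun h => hw.2 (.inr h)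
      rcases hu with hu | hu
      · exact hwB ((hA u hu w ⟨hw.1, hwA⟩ huw).2 ▸ hyB)
      · exact hwA ((hB u hu w ⟨hw.1, hwB⟩ huw).2 ▸ hxA)
    obtain ⟨u, hu, w, hw, u', hu', w', hw', h1, h2, h3⟩ := hcut A hAS ⟨x, hxA⟩
      (fun h => hyA.2 (h ▸ hyA.1))
    have e1 := hA u hu w hw h1
    have hw'B : w' ∈ B := (hunion ▸ hw'.1 : w' ∈ A ∪ B).resolve_left hw'.2
    have e2 := hB w' hw'B u' ⟨hAS hu', fun h => hdisj ⟨u', hu', h⟩⟩ h2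
    exact h3 ⟨e1.1.trans e2.2.symm, e1.2.trans e2.1.symm⟩
  intro a ha b hb
  obtain ⟨p, hp⟩ := exists_isPath_iff.2 (hcut.reach ha hb)
  obtain ⟨q, hq⟩ := exists_isPath_iff.2 (hcut.reach hb ha)
  have hsub : ∀ {a b p}, IsPath (ofEdges E) S a b p → IsPath G S a b p := fun h =>
    ⟨h.1.imp fun x y hxy => hEG _ hxy, h.2⟩
  exact ⟨p, q, hsub hp, hsub hq, fun x y hx hy =>
    htwin x y (hp.adj_of_usesEdge hx) (hq.adj_of_usesEdge hy)⟩

/-! ### Unions of twinless strongly connected sets, and TSCCs. -/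

theorem TwinlessStronglyConnected.reach {G : Digraph V} {S : Set V}
    (h : TwinlessStronglyConnected G S) {a b : V} (ha : a ∈ S) (hb : b ∈ S) : Reach G S a b := by
  obtain ⟨p, -, hp, -⟩ := h a ha b hb
  exact hp.reach

/-- A proper nonempty `A` must split `S` or `T`, since a common vertex forbids separating one from
the other; the edges crossing the split set serve for the union. -/
theorem TwinlessCuts.union {G : Digraph V} {S T : Set V} (hS : TwinlessCuts G S)
    (hT : TwinlessCuts G T) (hST : (S ∩ T).Nonempty) : TwinlessCuts G (S ∪ T) := by
  intro A hA hne hAne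
  have key : ∀ R ⊆ S ∪ T, TwinlessCuts G R → (A ∩ R).Nonempty → ¬ R ⊆ A →
      ∃ x ∈ A, ∃ y ∈ (S ∪ T) \ A, ∃ x' ∈ A, ∃ y' ∈ (S ∪ T) \ A,
        G.Adj x y ∧ G.Adj y' x' ∧ ¬ (x = x' ∧ y = y') := by
    intro R hR hc hne hsub
    obtain ⟨x, hx, y, hy, x', hx', y', hy', h⟩ := hc (A ∩ R) Set.inter_subset_right hne
      (fun h => hsub (Set.inter_eq_right.1 h))
    exact ⟨x, hx.1, y, ⟨hR hy.1, fun h => hy.2 ⟨h, hy.1⟩⟩, x', hx'.1, y',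
      ⟨hR hy'.1, fun h => hy'.2 ⟨h, hy'.1⟩⟩, h⟩
  by_contra hcon
  have kS : (A ∩ S).Nonempty → S ⊆ A := fun h => by
    by_contra hn
    exact hcon (key S Set.subset_union_left hS h hn)
  have kT : (A ∩ T).Nonempty → T ⊆ A := fun h => by
    by_contra hn
    exact hcon (key T Set.subset_union_right hT h hn)
  obtain ⟨c, hcS, hcT⟩ := hST
  obtain ⟨a, ha⟩ := hne
  refine hAne (hA.antisymm ?_)
  rcases hA ha with haS | haT
  · have h1 := kS ⟨a, ha, haS⟩
    exact Set.union_subset h1 (kT ⟨c, h1 hcS, hcT⟩)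
  · have h1 := kT ⟨a, ha, haT⟩
    exact Set.union_subset (kS ⟨c, h1 hcT, hcS⟩) h1

theorem TwinlessStronglyConnected.union [Finite V] {G : Digraph V} {S T : Set V}
    (hS : TwinlessStronglyConnected G S) (hT : TwinlessStronglyConnected G T)
    (hST : (S ∩ T).Nonempty) : TwinlessStronglyConnected G (S ∪ T) :=
  (hS.twinlessCuts.union hT.twinlessCuts hST).twinlessStronglyConnected

theorem exists_isTSCC_superset [Finite V] {G : Digraph V} {S U : Set V} (hU : U ⊆ S)
    (hne : U.Nonempty) (h : TwinlessStronglyConnected G U) : ∃ C, IsTSCC G S C ∧ U ⊆ C := by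
  obtain ⟨C, hUC, hC⟩ := (Set.toFinite {D : Set V | D ⊆ S ∧ D.Nonempty ∧
    TwinlessStronglyConnected G D}).exists_le_maximal ⟨hU, hne, h⟩
  exact ⟨C, hC, hUC⟩

theorem IsTSCC.eq_of_inter_nonempty [Finite V] {G : Digraph V} {S C D : Set V}
    (hC : IsTSCC G S C) (hD : IsTSCC G S D) (h : (C ∩ D).Nonempty) : C = D := by
  have hu : C ∪ D ⊆ S ∧ (C ∪ D).Nonempty ∧ TwinlessStronglyConnected G (C ∪ D) :=
    ⟨Set.union_subset hC.prop.1 hD.prop.1, hC.prop.2.1.inl, hC.prop.2.2.union hD.prop.2.2 h⟩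
  exact (hC.eq_of_subset hu Set.subset_union_left).trans
    (hD.eq_of_subset hu Set.subset_union_right).symm

theorem VertexTwinlessConnected.diff_singleton {G : Digraph V} {U : Set V}
    (h : VertexTwinlessConnected G 2 U) (v : V) : TwinlessStronglyConnected G (U \ {v}) := by
  by_cases hv : v ∈ U
  · exact h.2.2 {v} (by simpa using hv) (by simp)
  · rw [Set.sdiff_singleton_eq_self hv]
    exact h.1

/-! ### Dominators -/

theorem dominates_iff {G : Digraph V} {S : Set V} {v u x : V} :
    Dominates G S v u x ↔ u ∈ S ∧ x ∈ S ∧ ¬ Reach G (S \ {u}) v x := by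
  refine and_congr_right fun _ => and_congr_right fun _ => ?_
  rw [← exists_isPath_iff]
  constructor
  · rintro h ⟨p, hp⟩
    have hp' : IsPath G S v x p := ⟨hp.1, hp.2.1, hp.2.2.1, fun y hy => (hp.2.2.2 y hy).1⟩
    exact (hp.2.2.2 u (h p hp')).2 rfl
  · intro h p hp
    by_contra hu
    exact h ⟨p, hp.1, hp.2.1, hp.2.2.1, fun y hy =>
      ⟨hp.2.2.2 y hy, fun e => hu ((Set.mem_singleton_iff.1 e) ▸ hy)⟩⟩

theorem not_dominates_start {G : Digraph V} {S : Set V} {v u : V} (huv : u ≠ v) :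
    ¬ Dominates G S v u v := fun h =>
  (dominates_iff.1 h).2.2 (.refl ⟨h.2.1, fun e => huv e.symm⟩)

theorem start_dominates {G : Digraph V} {S : Set V} {v x : V} (hv : v ∈ S) (hx : x ∈ S) :
    Dominates G S v v x :=
  dominates_iff.2 ⟨hv, hx, fun h => h.left_mem.2 rfl⟩

theorem dominates_self {G : Digraph V} {S : Set V} {v x : V} (hx : x ∈ S) :
    Dominates G S v x x :=
  dominates_iff.2 ⟨hx, hx, fun h => h.right_mem.2 rfl⟩

theorem Reach.reach_or_avoid {G : Digraph V} {S : Set V} {y x : V} (b : V)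
    (h : Reach G S y x) : Reach G S y b ∨ Reach G (S \ {b}) y x := by
  obtain ⟨hy, h⟩ := h
  have hx : x ∈ S := Reach.right_mem ⟨hy, h⟩
  clear hy
  induction h using Relation.ReflTransGen.head_induction_on with
  | refl =>
    by_cases hb : x = b
    · exact .inl (hb ▸ .refl hx)
    · exact .inr (.refl ⟨hx, hb⟩)
  | head h' _ ih =>
    rename_i c d _
    rcases ih with ih | ih
    · exact .inl (.head h'.2.1 h'.1 ih)
    · by_cases hb : c = b
      · exact .inl (hb ▸ .refl h'.2.1)
      · exact .inr (.head ⟨h'.2.1, hb⟩ h'.1 ih)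

theorem Dominates.trans {G : Digraph V} {S : Set V} {v a b x : V} (hab : Dominates G S v a b)
    (hbx : Dominates G S v b x) : Dominates G S v a x := by
  rw [dominates_iff] at *
  refine ⟨hab.1, hbx.2.1, fun h => ?_⟩
  rcases h.reach_or_avoid b with h | h
  · exact hab.2.2 h
  · exact hbx.2.2 (h.mono fun y hy => ⟨hy.1.1, hy.2⟩)

/-- On a path to `x`, consider the last vertex that is `a` or `b`. -/
theorem Reach.avoid_pair {G : Digraph V} {S : Set V} {y x a b : V} (hab : a ≠ b) (hxa : x ≠ a)
    (hxb : x ≠ b) (h : Reach G S y x) :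
    Reach G (S \ {a, b}) y x ∨ Reach G (S \ {b}) a x ∨ Reach G (S \ {a}) b x := by
  obtain ⟨hy, h⟩ := h
  have hx : x ∈ S := Reach.right_mem ⟨hy, h⟩
  clear hy
  induction h using Relation.ReflTransGen.head_induction_on with
  | refl => exact .inl (.refl ⟨hx, by simp [hxa, hxb]⟩)
  | head h' _ ih =>
    rename_i c d _
    rcases ih with ih | ih
    · by_cases ha : c = a
      · subst ha
        exact .inr (.inl (.head ⟨h'.2.1, hab⟩ h'.1
          (ih.mono fun z hz => ⟨hz.1, fun e => hz.2 (.inr e)⟩)))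
      · by_cases hb : c = b
        · subst hb
          exact .inr (.inr (.head ⟨h'.2.1, hab.symm⟩ h'.1
            (ih.mono fun z hz => ⟨hz.1, fun e => hz.2 (.inl e)⟩)))
        · exact .inl (.head ⟨h'.2.1, by simp [ha, hb]⟩ h'.1 ih)
    · exact .inr ih

/-- If `a` is the last of the two on a path to `x`, the rest avoids `b`; were `b` not to dominate
`a`, a path to `x` avoiding `b` would result. -/
theorem dominates_total {G : Digraph V} {S : Set V} {v a b x : V} (hx : Reach G S v x)
    (hxa : a ≠ x) (hxb : b ≠ x) (ha : Dominates G S v a x) (hb : Dominates G S v b x) :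
    Dominates G S v a b ∨ Dominates G S v b a := by
  by_cases hab : a = b
  · exact .inl (hab ▸ dominates_self ha.1)
  by_contra! hcon
  have haS := ha.1
  have hbS := hb.1
  simp only [dominates_iff, haS, hbS, true_and, not_not] at hcon
  rw [dominates_iff] at ha hb
  rcases hx.avoid_pair hab hxa.symm hxb.symm with h | h | h
  · exact ha.2.2 (h.mono fun z hz => ⟨hz.1, fun e => hz.2 (.inl e)⟩)
  · exact hb.2.2 (hcon.2.trans h)
  · exact ha.2.2 (hcon.1.trans h)

theorem exists_isImmediateDominator [Finite V] {G : Digraph V} {S : Set V} {v x : V}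
    (hx : Reach G S v x) (hxv : x ≠ v) : ∃ w, IsImmediateDominator G S v w x := by
  -- By totality, the deepest proper dominator is the one that has the most dominators itself.
  obtain ⟨w, ⟨hwx, hw⟩, hmax⟩ := (Set.toFinite {u | u ≠ x ∧ Dominates G S v u x}).exists_maximalFor
    (fun u => {t | Dominates G S v t u}.ncard) _
    ⟨v, hxv.symm, start_dominates hx.left_mem hx.right_mem⟩
  refine ⟨w, hxv, hwx, hw, fun u hux hu => ?_⟩
  rcases dominates_total hx hux hwx hu hw with h | h
  · exact h
  · have hsub : {t | Dominates G S v t w} ⊆ {t | Dominates G S v t u} := fun t ht => ht.trans h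
    have heq := Set.eq_of_subset_of_ncard_le hsub
      (hmax ⟨hux, hu⟩ (Set.ncard_le_ncard hsub))
    exact (heq.symm ▸ dominates_self hu.1 : u ∈ {t | Dominates G S v t w})

theorem Dominates.antisymm {G : Digraph V} {S : Set V} {v a b : V} (ha : Reach G S v a)
    (hab : Dominates G S v a b) (hba : Dominates G S v b a) : a = b := by
  by_contra hne
  -- Look at the first visit to `{a, b}`.
  have key : ∀ {y}, Reach G S y a → Reach G (S \ {b}) y a ∨ Reach G (S \ {a}) y b := by
    intro y h
    obtain ⟨hy, h⟩ := h
    have ha : a ∈ S := Reach.right_mem ⟨hy, h⟩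
    clear hy
    induction h using Relation.ReflTransGen.head_induction_on with
    | refl => exact .inl (.refl ⟨ha, hne⟩)
    | head h' _ ih =>
      rename_i c d _
      by_cases hca : c = a
      · exact .inl (hca.symm ▸ .refl ⟨ha, hne⟩)
      · by_cases hcb : c = b
        · exact .inr (hcb.symm ▸ .refl ⟨hab.2.1, fun e => hne e.symm⟩)
        · rcases ih with ih | ih
          · exact .inl (.head ⟨h'.2.1, hcb⟩ h'.1 ih)
          · exact .inr (.head ⟨h'.2.1, hca⟩ h'.1 ih)
  rcases key ha with h | h
  · exact (dominates_iff.1 hba).2.2 h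
  · exact (dominates_iff.1 hab).2.2 h

theorem IsImmediateDominator.unique {G : Digraph V} {S : Set V} {v w w' x : V}
    (hS : ∀ y ∈ S, Reach G S v y) (h : IsImmediateDominator G S v w x)
    (h' : IsImmediateDominator G S v w' x) : w = w' :=
  Dominates.antisymm (hS w h.2.2.1.1) (h'.2.2.2 w h.2.1 h.2.2.1) (h.2.2.2 w' h'.2.1 h'.2.2.1)

/-- A subset that stays strongly connected after the removal of any one vertex lies in
`M(w) ∪ {w}` for some `w`. -/
theorem exists_subset_directSuccessors [Finite V] {G : Digraph V} {S U : Set V} {v : V}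
    (hS : ∀ y ∈ S, Reach G S v y) (hU : U ⊆ S) (hne : U.Nonempty) (hv : v ∈ S)
    (hconn : ∀ u, ∀ a ∈ U \ {u}, ∀ b ∈ U \ {u}, Reach G (U \ {u}) a b) :
    ∃ w ∈ S, U ⊆ directSuccessors G S v w ∪ {w} := by
  -- A path to `z` avoiding `y` extends inside `U \ {y}` to one to `x`.
  have key : ∀ y, ∀ x ∈ U, ∀ z ∈ U, y ≠ x → y ≠ z → Dominates G S v y x →
      Dominates G S v y z := by
    intro y x hx z hz hyx hyz hd
    rw [dominates_iff] at *
    refine ⟨hd.1, hU hz, fun h => hd.2.2 (h.trans ?_)⟩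
    exact (hconn y z ⟨hz, hyz.symm⟩ x ⟨hx, hyx.symm⟩).mono (Set.sdiff_subset_sdiff_left hU)
  -- If a member `w` dominates another, it is the immediate dominator of all other members. If none
  -- does, all members share their dominators outside `U`, hence their immediate dominator; `U =
  -- {v}` is the exception.
  by_cases hcase : ∃ w ∈ U, ∃ x ∈ U, w ≠ x ∧ Dominates G S v w x
  · obtain ⟨w, hw, x, hx, hwx, hd⟩ := hcase
    refine ⟨w, hU hw, fun z hz => ?_⟩
    by_cases hzw : z = w
    · exact .inr hzw
    · have hwz := key w x hx z hz hwx (Ne.symm hzw) hd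
      refine .inl ⟨?_, Ne.symm hzw, hwz, fun u huz hu => ?_⟩
      · rintro rfl
        exact not_dominates_start (Ne.symm hzw) hwz
      · by_cases huw : u = w
        · exact huw.symm ▸ dominates_self (hU hw)
        · exact key u z hz w hw huz huw hu
  · push Not at hcase
    have hvU : v ∉ U ∨ U = {v} := by
      by_contra! hcon
      obtain ⟨hvU, hne'⟩ := hcon
      refine hne' (Set.eq_singleton_iff_unique_mem.2 ⟨hvU, fun z hz => ?_⟩)
      by_contra hzv
      exact hcase v hvU z hz (Ne.symm hzv) (start_dominates hv (hU hz))
    rcases hvU with hvU | rfl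
    · obtain ⟨x, hx⟩ := hne
      have hnv : ∀ z ∈ U, z ≠ v := fun z hz e => hvU (e ▸ hz)
      obtain ⟨w, hxv, hwx, hd, hw⟩ := exists_isImmediateDominator (hS x (hU hx)) (hnv x hx)
      have hwU : w ∉ U := fun h => hcase w h x hx hwx hd
      refine ⟨w, hd.1, fun z hz => .inl ⟨hnv z hz, fun e => hwU (e ▸ hz),
        key w x hx z hz hwx (fun e => hwU (e ▸ hz)) hd, fun u huz hu => ?_⟩⟩
      have huU : u ∉ U := fun h => hcase u h z hz huz hu
      have hux : u ≠ x := fun e => huU (e ▸ hx)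
      exact hw u hux (key u z hz x hx huz hux hu)
    · exact ⟨v, hv, fun z hz => .inr hz⟩

theorem dominates_reverse_iff_of_start {G : Digraph V} {S : Set V} {v u x : V} :
    Dominates (reverse G) S v u x ↔ u ∈ S ∧ x ∈ S ∧ ¬ Reach G (S \ {u}) x v := by
  rw [dominates_iff, reach_reverse]

/-- If neither the flowgraph nor the reverse flowgraph has a non-trivial dominator, then only the
start vertex can be a strong articulation point. -/
theorem stronglyConnected_diff_of_no_dominators {G : Digraph V} {S : Set V} {v u : V}
    (h : ∀ u, ¬ IsNontrivialDominator G S v u)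
    (h' : ∀ u, ¬ IsNontrivialDominator (reverse G) S v u) (hu : u ∈ S) (huv : u ≠ v) :
    StronglyConnected G (S \ {u}) := by
  have h1 : ∀ x ∈ S \ {u}, Reach G (S \ {u}) v x := fun x hx => by
    by_contra hn
    exact h u ⟨huv, x, hx.2, dominates_iff.2 ⟨hu, hx.1, hn⟩⟩
  have h2 : ∀ x ∈ S \ {u}, Reach G (S \ {u}) x v := fun x hx => by
    by_contra hn
    exact h' u ⟨huv, x, hx.2, dominates_reverse_iff_of_start.2 ⟨hu, hx.1, hn⟩⟩
  exact stronglyConnected_iff.2 fun a ha b hb => (h2 a ha).trans (h1 b hb)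

/-! ### The recursive calls -/

theorem AdmissibleTree.eq_or_eq {G D : Digraph V} {S : Set V} {v : V}
    (h : AdmissibleTree G S v D) : D = G ∨ D = reverse G :=
  h.imp (·.1) (·.1)

theorem AdmissibleTree.no_dominators [Finite V] {G D : Digraph V} {S : Set V} {v : V}
    (hD : AdmissibleTree G S v D) (h : ∀ u, ¬ IsNontrivialDominator D S v u) :
    (∀ u, ¬ IsNontrivialDominator G S v u) ∧ ∀ u, ¬ IsNontrivialDominator (reverse G) S v u := by
  have hempty : {u | IsNontrivialDominator D S v u} = ∅ :=
    Set.eq_empty_of_forall_notMem h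
  have key : ∀ H : Digraph V, {u | IsNontrivialDominator H S v u}.ncard ≤
      {u | IsNontrivialDominator D S v u}.ncard → ∀ u, ¬ IsNontrivialDominator H S v u := by
    intro H hH u hu
    rw [hempty, Set.ncard_empty, Nat.le_zero, Set.ncard_eq_zero] at hH
    exact (Set.eq_empty_iff_forall_notMem.1 hH) u hu
  rcases hD with ⟨rfl, hle⟩ | ⟨rfl, hle⟩
  · exact ⟨h, key _ hle⟩
  · exact ⟨key _ hle, h⟩

theorem exists_strongArticulationPoint {G : Digraph V} {S : Set V} (hS : StronglyConnected G S)
    (h3 : 3 ≤ S.ncard) (h : ¬ VertexConnected G 2 S) : ∃ u, IsStrongArticulationPoint G S u := by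
  by_contra! hcon
  refine h ⟨hS, h3, fun U hU hc => ?_⟩
  -- Since `ncard` is `0` on infinite sets, finiteness is needed to conclude that `U` is empty.
  have hfin : U.Finite := (Set.finite_of_ncard_pos (by omega : 0 < S.ncard)).subset hU
  rcases (by omega : U.ncard = 0 ∨ U.ncard = 1) with h0 | h1
  · rw [(Set.ncard_eq_zero hfin).1 h0, Set.sdiff_empty]
    exact hS
  · obtain ⟨u, rfl⟩ := Set.ncard_eq_one.1 h1
    by_contra hn
    exact hcon u ⟨hU rfl, hn⟩

theorem directSuccessors_subset {G : Digraph V} {S : Set V} {v w : V} :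
    directSuccessors G S v w ⊆ S := fun _ hx => hx.2.2.1.2.1

/-- This gives termination, and it is where the rules for choosing the start vertex and the tree
matter. -/
theorem directSuccessors_union_ne [Finite V] {G D : Digraph V} {S : Set V} {v w : V}
    (hS : StronglyConnected G S) (h : ¬ VertexConnected G 2 S) (hv : AdmissibleStart G S v)
    (hD : AdmissibleTree G S v D) (hw : 2 ≤ (directSuccessors D S v w).ncard) :
    directSuccessors D S v w ∪ {w} ≠ S := by
  intro heq
  have hwM : w ∉ directSuccessors D S v w := fun h => h.2.1 rfl
  have h3 : 3 ≤ S.ncard := by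
    rw [← heq, Set.union_singleton, Set.ncard_insert_of_notMem hwM]
    omega
  -- The start vertex has no immediate dominator, so it is not in `M(w)`.
  obtain rfl : v = w := by
    rcases (heq.symm ▸ hv.1 : v ∈ directSuccessors D S v w ∪ {w}) with h | h
    · exact absurd rfl h.1
    · exact h
  -- All other vertices are now children of `v`, so a non-trivial dominator would have to dominate
  -- `v`.
  have hno : ∀ u, ¬ IsNontrivialDominator D S v u := by
    rintro u ⟨huv, x, hxu, hd⟩
    rcases (heq.symm ▸ hd.2.1 : x ∈ directSuccessors D S v v ∪ {v}) with h | h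
    · exact not_dominates_start huv (h.2.2.2 u hxu.symm hd)
    · rw [Set.mem_singleton_iff.1 h] at hd
      exact not_dominates_start huv hd
  obtain ⟨h1, h2⟩ := hD.no_dominators hno
  have hsc := fun u => stronglyConnected_diff_of_no_dominators (u := u) h1 h2
  rcases hv.2 with hall | hnot
  · obtain ⟨u, huS, huv⟩ := Set.exists_ne_of_one_lt_ncard (by omega : 1 < S.ncard) v
    exact (hall u huS).2 (hsc u huS huv)
  · obtain ⟨u, hu⟩ := exists_strongArticulationPoint hS h3 h
    by_cases huv : u = v
    · exact hnot (huv ▸ hu)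
    · exact hu.2 (hsc u hu.1 huv)

theorem DominatorCall.subset_union {G D : Digraph V} {S C : Set V} {v w : V}
    (h : DominatorCall G S v D w C) : C ⊆ directSuccessors D S v w ∪ {w} := by
  rcases h.2.2 with h | h
  · exact h.2.1.prop.1
  · exact h.2.subset

theorem DominatorCall.union_subset {G D : Digraph V} {S C : Set V} {v w : V}
    (h : DominatorCall G S v D w C) : directSuccessors D S v w ∪ {w} ⊆ S :=
  Set.union_subset directSuccessors_subset (by simpa using h.1)

theorem DominatorCall.twinlessStronglyConnected {G D : Digraph V} {S C : Set V} {v w : V}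
    (h : DominatorCall G S v D w C) : TwinlessStronglyConnected G C ∧ C.Nonempty := by
  rcases h.2.2 with h | h
  · exact ⟨h.2.1.prop.2.2, h.2.1.prop.2.1⟩
  · exact h.2 ▸ ⟨h.1, w, .inr rfl⟩

theorem reach_of_admissibleTree {G D : Digraph V} {S T : Set V} {v : V}
    (hD : AdmissibleTree G S v D) (h : ∀ a ∈ T, ∀ b ∈ T, Reach G T a b) :
    ∀ a ∈ T, ∀ b ∈ T, Reach D T a b := by
  intro a ha b hb
  rcases hD.eq_or_eq with rfl | rfl
  · exact h a ha b hb
  · exact reach_reverse.2 (h b hb a ha)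

theorem exists_dominatorCall_superset [Finite V] {G D : Digraph V} {S U : Set V} {v : V}
    (hS : TwinlessStronglyConnected G S) (hv : v ∈ S) (hD : AdmissibleTree G S v D) (hUS : U ⊆ S)
    (hU : VertexTwinlessConnected G 2 U) : ∃ w C, DominatorCall G S v D w C ∧ U ⊆ C := by
  have h3 : 3 ≤ U.ncard := hU.2.1
  have hne : U.Nonempty := Set.nonempty_of_ncard_ne_zero (by omega)
  obtain ⟨w, hwS, hw⟩ := exists_subset_directSuccessors
    (reach_of_admissibleTree hD (fun a ha b hb => hS.reach ha hb) v hv) hUS hne hv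
    (fun u => reach_of_admissibleTree hD
      fun a ha b hb => (hU.diff_singleton u).reach ha hb)
  -- At least three vertices of `U`, minus possibly `w`.
  have hM : 2 ≤ (directSuccessors D S v w).ncard := by
    have h1 := Set.ncard_le_ncard hw
    have h2 := Set.ncard_union_le (directSuccessors D S v w) {w}
    rw [Set.ncard_singleton] at h2
    omega
  by_cases ht : TwinlessStronglyConnected G (directSuccessors D S v w ∪ {w})
  · exact ⟨w, _, ⟨hwS, hM, .inr ⟨ht, rfl⟩⟩, hw⟩
  · obtain ⟨C, hC, hUC⟩ := exists_isTSCC_superset hw hne hU.1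
    exact ⟨w, C, ⟨hwS, hM, .inl ⟨ht, hC, h3.trans (Set.ncard_le_ncard hUC)⟩⟩, hUC⟩

theorem DominatorCall.eq_of_subset [Finite V] {G D : Digraph V} {S U C C' : Set V} {v w w' : V}
    (hS : ∀ y ∈ S, Reach D S v y) (h : DominatorCall G S v D w C)
    (h' : DominatorCall G S v D w' C') (hC : U ⊆ C) (hC' : U ⊆ C') (h3 : 3 ≤ U.ncard) :
    C = C' := by
  -- A vertex common to both parts is `w`, `w'`, or has two immediate dominators; `U` is too large
  -- for the first two alone.
  obtain rfl : w = w' := by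
    by_contra hne
    have hsub : U ⊆ {w, w'} := by
      intro x hx
      rcases h.subset_union (hC hx) with hxw | hxw
      · rcases h'.subset_union (hC' hx) with hxw' | hxw'
        · exact absurd (IsImmediateDominator.unique hS hxw hxw') hne
        · exact .inr hxw'
      · exact .inl hxw
    have h1 := Set.ncard_le_ncard hsub
    rw [Set.ncard_pair hne] at h1
    omega
  rcases h.2.2 with h1 | h1 <;> rcases h'.2.2 with h2 | h2
  · obtain ⟨x, hx⟩ : U.Nonempty := Set.nonempty_of_ncard_ne_zero (by omega)
    exact h1.2.1.eq_of_inter_nonempty h2.2.1 ⟨x, hC hx, hC' hx⟩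
  · exact absurd h2.1 h1.1
  · exact absurd h1.1 h2.1
  · rw [h1.2, h2.2]

/-- If `C = S`, then `B = S \ {v}` would be twinless strongly connected, although `v` is an
articulation point. -/
theorem ArticulationCall.ssubset {G : Digraph V} {S B C : Set V} {v : V}
    (hv : IsTwinlessArticulationPoint G S v) (h : ArticulationCall G S v B C) : C ⊂ S := by
  have hB : B ∪ {v} ⊆ S :=
    Set.union_subset (h.1.prop.1.trans Set.sdiff_subset) (by simpa using hv.1)
  refine (h.2.prop.1.trans hB).ssubset_of_ne fun heq => hv.2 ?_
  have hBS : S \ {v} ⊆ B := fun x hx => by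
    rcases h.2.prop.1 (heq ▸ hx.1) with h | h
    · exact h
    · exact absurd h hx.2
  exact h.1.prop.1.antisymm hBS ▸ h.1.prop.2.2

theorem exists_articulationCall_superset [Finite V] {G : Digraph V} {S U : Set V} (v : V)
    (hUS : U ⊆ S) (hU : VertexTwinlessConnected G 2 U) :
    ∃ B C, ArticulationCall G S v B C ∧ U ⊆ C := by
  have h3 : 3 ≤ U.ncard := hU.2.1
  obtain ⟨u, hu, huv⟩ := Set.exists_ne_of_one_lt_ncard (by omega : 1 < U.ncard) v
  obtain ⟨B, hB, hUB⟩ := exists_isTSCC_superset (Set.sdiff_subset_sdiff_left hUS)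
    ⟨u, hu, huv⟩ (hU.diff_singleton v)
  obtain ⟨C, hC, hUC⟩ := exists_isTSCC_superset (S := B ∪ {v}) (U := U) (fun x hx => by
    by_cases hxv : x = v
    · exact .inr hxv
    · exact .inl (hUB ⟨hx, hxv⟩)) ⟨u, hu⟩ hU.1
  exact ⟨B, C, ⟨hB, hC⟩, hUC⟩

theorem ArticulationCall.eq_of_subset [Finite V] {G : Digraph V} {S U B C B' C' : Set V} {v : V}
    (h : ArticulationCall G S v B C) (h' : ArticulationCall G S v B' C') (hC : U ⊆ C)
    (hC' : U ⊆ C') (h3 : 3 ≤ U.ncard) : C = C' := by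
  obtain ⟨u, hu, huv⟩ := Set.exists_ne_of_one_lt_ncard (by omega : 1 < U.ncard) v
  obtain rfl : B = B' := h.1.eq_of_inter_nonempty h'.1
    ⟨u, (h.2.prop.1 (hC hu)).resolve_right huv, (h'.2.prop.1 (hC' hu)).resolve_right huv⟩
  exact h.2.eq_of_inter_nonempty h'.2 ⟨u, hC hu, hC' hu⟩

theorem exists_twinlessArticulationPoint {G : Digraph V} {S : Set V}
    (hS : TwinlessStronglyConnected G S) (h : VertexConnected G 2 S)
    (h' : ¬ VertexTwinlessConnected G 2 S) : ∃ u, IsTwinlessArticulationPoint G S u := by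
  have h3 : 3 ≤ S.ncard := h.2.1
  by_contra! hcon
  refine h' ⟨hS, h3, fun U hU hc => ?_⟩
  have hfin : U.Finite := (Set.finite_of_ncard_pos (by omega : 0 < S.ncard)).subset hU
  rcases (by omega : U.ncard = 0 ∨ U.ncard = 1) with h0 | h1
  · rw [(Set.ncard_eq_zero hfin).1 h0, Set.sdiff_empty]
    exact hS
  · obtain ⟨u, rfl⟩ := Set.ncard_eq_one.1 h1
    by_contra hn
    exact hcon u ⟨hU rfl, hn⟩

/-! ### Correctness -/

/-- The `2`-vertex-twinless-connected components of `G[S]`. -/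
def components (G : Digraph V) (S : Set V) : Set (Set V) :=
  {U | Maximal (fun D => D ⊆ S ∧ VertexTwinlessConnected G 2 D) U}

theorem components_of_connected {G : Digraph V} {S : Set V} (h : VertexTwinlessConnected G 2 S) :
    components G S = {S} := by
  ext U
  simp only [components, Set.mem_ofPred_eq, Set.mem_singleton_iff]
  refine ⟨fun hU => hU.eq_of_subset ⟨subset_rfl, h⟩ hU.prop.1, ?_⟩
  rintro rfl
  exact ⟨⟨subset_rfl, h⟩, fun D hD _ => hD.1⟩

/-- If every `2`-vertex-twinless-connected subset lies in one of the parts `C`, and two parts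
containing the same such subset are equal, then the components are those of the parts. -/
theorem components_eq_of_calls {ι : Type*} {G : Digraph V} {S : Set V} {call : ι → Set V → Prop}
    (hsub : ∀ i C, call i C → C ⊆ S)
    (hex : ∀ U ⊆ S, VertexTwinlessConnected G 2 U → ∃ i C, call i C ∧ U ⊆ C)
    (huniq : ∀ U i C j C', 3 ≤ U.ncard → call i C → call j C' → U ⊆ C → U ⊆ C' → C = C') :
    {U | ∃ i C, call i C ∧ U ∈ components G C} = components G S := by
  ext U
  simp only [components, Set.mem_ofPred_eq]
  constructor
  · rintro ⟨i, C, hC, hU⟩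
    refine ⟨⟨hU.prop.1.trans (hsub i C hC), hU.prop.2⟩, fun D hD hUD => ?_⟩
    obtain ⟨j, C', hC', hDC'⟩ := hex D hD.1 hD.2
    -- The larger set `D` might lie in another part, but that part also contains `U`, so it is `C`.
    obtain rfl := huniq U i C j C' hU.prop.2.2.1 hC hC' hU.prop.1 (hUD.trans hDC')
    exact hU.2 ⟨hDC', hD.2⟩ hUD
  · intro hU
    obtain ⟨i, C, hC, hUC⟩ := hex U hU.prop.1 hU.prop.2
    exact ⟨i, C, hC, ⟨hUC, hU.prop.2⟩, fun D hD => hU.2 ⟨hD.1.trans (hsub i C hC), hD.2⟩⟩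

theorem exists_admissibleStart {G : Digraph V} {S : Set V} (hS : S.Nonempty) :
    ∃ v, AdmissibleStart G S v := by
  by_cases h : ∀ x ∈ S, IsStrongArticulationPoint G S x
  · exact ⟨hS.some, hS.some_mem, .inl h⟩
  · push Not at h
    obtain ⟨x, hx, hn⟩ := h
    exact ⟨x, hx, .inr hn⟩

theorem exists_admissibleTree (G : Digraph V) (S : Set V) (v : V) :
    ∃ D, AdmissibleTree G S v D :=
  (le_total {u | IsNontrivialDominator (reverse G) S v u}.ncard
    {u | IsNontrivialDominator G S v u}.ncard).elim
    (fun h => ⟨_, .inl ⟨rfl, h⟩⟩) (fun h => ⟨_, .inr ⟨rfl, h⟩⟩)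

theorem dominator_components [Finite V] {G D : Digraph V} {S : Set V} {v : V}
    (hS : TwinlessStronglyConnected G S) (hv : AdmissibleStart G S v)
    (hD : AdmissibleTree G S v D) :
    {U | ∃ w C, DominatorCall G S v D w C ∧ U ∈ components G C} = components G S :=
  components_eq_of_calls (call := DominatorCall G S v D)
    (fun _ _ h => h.subset_union.trans h.union_subset)
    (fun _ hU h => exists_dominatorCall_superset hS hv.1 hD hU h)
    (fun _ _ _ _ _ h3 h h' hC hC' => h.eq_of_subset
      (reach_of_admissibleTree hD (fun _ ha _ hb => hS.reach ha hb) v hv.1) h' hC hC' h3)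

theorem articulation_components [Finite V] {G : Digraph V} {S : Set V} {v : V}
    (hv : IsTwinlessArticulationPoint G S v) :
    {U | ∃ B C, ArticulationCall G S v B C ∧ U ∈ components G C} = components G S :=
  components_eq_of_calls (call := ArticulationCall G S v) (fun _ _ h => (h.ssubset hv).subset)
    (fun _ hU h => exists_articulationCall_superset v hU h)
    (fun _ _ _ _ _ h3 h h' hC hC' => h.eq_of_subset h' hC hC' h3)

theorem DominatorCall.ssubset [Finite V] {G D : Digraph V} {S C : Set V} {v w : V}
    (hS : TwinlessStronglyConnected G S) (h : ¬ VertexConnected G 2 S)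
    (hv : AdmissibleStart G S v) (hD : AdmissibleTree G S v D)
    (hC : DominatorCall G S v D w C) : C ⊂ S :=
  hC.subset_union.trans_ssubset (hC.union_subset.ssubset_of_ne (directSuccessors_union_ne
    (stronglyConnected_iff.2 fun _ ha _ hb => hS.reach ha hb) h hv hD hC.2.1))

/-- Describing all possible outputs by an equivalence covers both that every finished execution is
correct and that one exists; in the latter, each call returns its `components`. -/
theorem terminates_and_computes_iff [Finite V] (G : Digraph V) (S : Set V)
    (hS : TwinlessStronglyConnected G S) (hne : S.Nonempty) :
    Terminates G S ∧ ∀ out, Computes G S out ↔ out = components G S := by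
  induction S using WellFoundedLT.induction with
  | ind S ih =>
  by_cases h2 : VertexTwinlessConnected G 2 S
  · refine ⟨.connected S h2, fun out => ⟨fun h => ?_, ?_⟩⟩
    · cases h with
      | connected => exact (components_of_connected h2).symm
      | dominator _ h => exact absurd h2 h
      | articulation _ h => exact absurd h2 h
    · rintro rfl
      exact components_of_connected h2 ▸ .connected S h2
  by_cases hc : VertexConnected G 2 S
  · have hcall : ∀ v B C, IsTwinlessArticulationPoint G S v → ArticulationCall G S v B C →
        Terminates G C ∧ ∀ out, Computes G C out ↔ out = components G C :=
      fun v B C hv h => ih C (h.ssubset hv) h.2.prop.2.2 h.2.prop.2.1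
    obtain ⟨v, hv⟩ := exists_twinlessArticulationPoint hS hc h2
    refine ⟨.articulation S h2 hc ⟨v, hv⟩ fun v B C hv h => (hcall v B C hv h).1,
      fun out => ⟨fun h => ?_, ?_⟩⟩
    · cases h with
      | connected _ h => exact absurd h h2
      | dominator _ _ h => exact absurd hc h
      | articulation _ _ _ v hv res hres =>
        rw [← articulation_components hv]
        ext U
        refine exists_congr fun B => exists_congr fun C => and_congr_right fun h => ?_
        rw [((hcall v B C hv h).2 _).1 (hres B C h)]
    · rintro rfl
      rw [← articulation_components hv]
      exact .articulation S h2 hc v hv (fun _ C => components G C)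
        fun B C h => ((hcall v B C hv h).2 _).2 rfl
  · have hcall : ∀ v D w C, AdmissibleStart G S v → AdmissibleTree G S v D →
        DominatorCall G S v D w C →
        Terminates G C ∧ ∀ out, Computes G C out ↔ out = components G C :=
      fun v D w C hv hD h => ih C (h.ssubset hS hc hv hD) h.twinlessStronglyConnected.1
        h.twinlessStronglyConnected.2
    refine ⟨.dominator S h2 hc (exists_admissibleStart hne) (fun v _ => exists_admissibleTree G S v)
      fun v D w C hv hD h => (hcall v D w C hv hD h).1, fun out => ⟨fun h => ?_, ?_⟩⟩
    · cases h with
      | connected _ h => exact absurd h h2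
      | articulation _ _ h => exact absurd h hc
      | dominator _ _ _ v hv D hD res hres =>
        rw [← dominator_components hS hv hD]
        ext U
        refine exists_congr fun w => exists_congr fun C => and_congr_right fun h => ?_
        rw [((hcall v D w C hv hD h).2 _).1 (hres w C h)]
    · rintro rfl
      obtain ⟨v, hv⟩ := exists_admissibleStart (G := G) hne
      obtain ⟨D, hD⟩ := exists_admissibleTree G S v
      rw [← dominator_components hS hv hD]
      exact .dominator S h2 hc v hv D hD (fun _ C => components G C)
        fun w C h => ((hcall v D w C hv hD h).2 _).2 rfl

end Twinless

theorem mainTheorem10 {V : Type*} [Finite V] [Nonempty V] (G : Digraph V)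
    (hG : Twinless.TwinlessStronglyConnected G Set.univ) :
    Twinless.Terminates G Set.univ ∧
      ∀ out : Set (Set V),
        Twinless.Computes G Set.univ out ↔ out = {C | Twinless.IsTwoVTCC G C} := by
  have h := Twinless.terminates_and_computes_iff G Set.univ hG Set.univ_nonempty
  simpa [Twinless.components, Twinless.IsTwoVTCC] using h
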